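/- Let $\mathcal X$ be a finite non-empty set of $X=|\mathcal X|$ actions, let $\sigma>0$ and $\delta\in(0,1)$, and let $f$ be a zero-mean Gaussian process on $\mathcal X$ with covariance kernel $\kappa$. Let the noise variables $\epsilon_1,\epsilon_2,\dots$ be independent with law $\mathcal N(0,\sigma^2)$ and independent of $f$. For a finite dictionary $D=(d_1,\dots,d_M)$ of actions with observations $y_D\in\mathbb R^M$, put $K_D=(\kappa(d_i,d_j))_{i,j}$, $k_D(x)=(\kappa(d_i,x))_i$, $$\mu_D(x)=k_D(x)^\top(K_D+\sigma^2I)^{-1}y_D,\qquad \sigma_D^2(x)=\kappa(x,x)-k_D(x)^\top(K_D+\sigma^2I)^{-1}k_D(x),$$ and let $H(y_D)=\tfrac12\log\det\big(2\pi e(K_D+\sigma^2I)\big)$ be the (Gaussian) entropy of the observations, with $H=0$ for the empty dictionary. Let $\beta_t=2\log\!\big(Xt^2\pi^2/(6\delta)\big)$. Compressed GP-UCB with compression budget $\epsilon>0$ starts with the empty dictionary $D_0$. In round $t=1,2,\dots$ it selects $x_t\in\arg\max_{x\in\mathcal X}\big(\mu_{D_{t-1}}(x)+\sqrt{\beta_t}\,\sigma_{D_{t-1}}(x)\big)$,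 ties being broken by a fixed measurable rule that may depend on $t$. If $\tfrac12\log\!\big(2\pi e(\sigma^2+\sigma^2_{D_{t-1}}(x_t))\big)>\epsilon$, it observes $y_t=f(x_t)+\epsilon_t$ and appends $(x_t,y_t)$ to the dictionary; otherwise it takes no sample and $D_t=D_{t-1}$. Let $\mathcal M_T(\epsilon)$ be the set of rounds $t\le T$ in which a sample is taken, and let $$\widetilde{\mathbf{Reg}}_T=\sum_{t\in\mathcal M_T(\epsilon)}\Big(\max_{x\in\mathcal X}f(x)-f(x_t)\Big).$$ Assume that the finite-entropy (finite Shannon capacity) condition $\lim_{t\to\infty}H(y_{D_t})\le C$ holds almost surely for the run with budget $\epsilon$. Put $$C_1=\frac{8}{\log(1+\sigma^{-2})},\qquad Z_1=\frac{\sum_{x\in\mathcal X}\kappa(x,x)}{\sigma^2(1-e^{-1})}.$$ (1) For every $T\ge1$, $$\mathbb P\Big\{\widetilde{\mathbf{Reg}}_T\le\sqrt{C_1Z_1\beta_T}\,\min\{C/\epsilon,\,T\}\Big\}\ge1-\delta .$$ (2) There is a constant $K$, depending only on $\mathcal X,\kappa,\sigma,\delta$, such that for all $C>0$ and $T\ge1$,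 if the algorithm is run with $\epsilon=C/\sqrt T$ and the finite-entropy condition holds for this run with this $C$, then $\mathbb P\{\widetilde{\mathbf{Reg}}_T\le K\sqrt T\}\ge1-\delta$, and the dictionary $D_T$ has almost surely at most $\sqrt T$ elements. -/

import Mathlib

open MeasureTheory ProbabilityTheory Filter
open scoped Topology Matrix

noncomputable section

namespace GPBandit

variable {𝒳 : Type*}

/-- A dictionary together with its target vector: the retained pairs `(x_u, y_u)`, in the order in
which they were retained. -/
abbrev Dict (𝒳 : Type*) := List (𝒳 × ℝ)

/-- The covariance matrix `K_{D,D} + σ² I` of the retained noisy observations. -/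
def noisyGram (κ : 𝒳 → 𝒳 → ℝ) (σ : ℝ) (D : Dict 𝒳) : Matrix (Fin D.length) (Fin D.length) ℝ :=
  Matrix.of (fun i j => κ (D.get i).1 (D.get j).1) + σ ^ 2 • (1 : Matrix _ _ ℝ)

/-- The empirical kernel map `k_D(x)`. -/
def kernelVec (κ : 𝒳 → 𝒳 → ℝ) (D : Dict 𝒳) (x : 𝒳) : Fin D.length → ℝ :=
  fun i => κ (D.get i).1 x

/-- The target vector `y_D`. -/
def targetVec (D : Dict 𝒳) : Fin D.length → ℝ :=
  fun i => (D.get i).2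

/-- Posterior mean `μ_D(x) = k_D(x)ᵀ (K_{D,D} + σ² I)⁻¹ y_D`. -/
def posteriorMean (κ : 𝒳 → 𝒳 → ℝ) (σ : ℝ) (D : Dict 𝒳) (x : 𝒳) : ℝ :=
  kernelVec κ D x ⬝ᵥ ((noisyGram κ σ D)⁻¹ *ᵥ targetVec D)

/-- Posterior variance `σ_D²(x) = κ(x,x) - k_D(x)ᵀ (K_{D,D} + σ² I)⁻¹ k_D(x)`. -/
def posteriorVar (κ : 𝒳 → 𝒳 → ℝ) (σ : ℝ) (D : Dict 𝒳) (x : 𝒳) : ℝ :=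
  κ x x - kernelVec κ D x ⬝ᵥ ((noisyGram κ σ D)⁻¹ *ᵥ kernelVec κ D x)

/-- The upper-confidence bound acquisition function `μ_D(x) + √b σ_D(x)`. -/
def ucb (κ : 𝒳 → 𝒳 → ℝ) (σ b : ℝ) (D : Dict 𝒳) (x : 𝒳) : ℝ :=
  posteriorMean κ σ D x + √b * √(posteriorVar κ σ D x)

/-- Entropy `½ log det (2πe S)` of a Gaussian vector with covariance matrix `S`. -/
def gaussianEntropy {n : ℕ} (S : Matrix (Fin n) (Fin n) ℝ) : ℝ :=
  1 / 2 * Real.log ((2 * Real.pi * Real.exp 1) • S).det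

/-- Entropy `H(y_D)` of the retained observations. -/
def obsEntropy (κ : 𝒳 → 𝒳 → ℝ) (σ : ℝ) (D : Dict 𝒳) : ℝ :=
  gaussianEntropy (noisyGram κ σ D)

/-- Conditional entropy `H(y | y_D) = ½ log (2πe (σ² + σ_D²(x)))` of a new noisy observation `y`
at the point `x`. -/
def condEntropy (κ : 𝒳 → 𝒳 → ℝ) (σ : ℝ) (D : Dict 𝒳) (x : 𝒳) : ℝ :=
  1 / 2 * Real.log (2 * Real.pi * Real.exp 1 * (σ ^ 2 + posteriorVar κ σ D x))

/-- The exploration parameter `β_t = 2 log (X t² π² / (6 δ))`, with `X` the number of actions. -/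
def beta (X : ℕ) (δ : ℝ) (t : ℕ) : ℝ :=
  2 * Real.log (X * (t : ℝ) ^ 2 * Real.pi ^ 2 / (6 * δ))

/-- A measurable rule that returns, at each time, a maximizer of a given function on the
actions. The choice among several maximizers is free and may change with time. -/
structure IsArgmaxRule (argmax : ℕ → (𝒳 → ℝ) → 𝒳) : Prop where
  le_argmax : ∀ (t : ℕ) (g : 𝒳 → ℝ) (x : 𝒳), g x ≤ g (argmax t g)
  measurable : ∀ (t : ℕ) (a : 𝒳), MeasurableSet {g : 𝒳 → ℝ | argmax t g = a}

section Algorithm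

variable [Fintype 𝒳] (κ : 𝒳 → 𝒳 → ℝ) (σ δ ε : ℝ) (argmax : ℕ → (𝒳 → ℝ) → 𝒳)
  (f : 𝒳 → ℝ) (noise : ℕ → ℝ)

/-- The dictionary `D_t` of compressed GP-UCB along one sample path of the payoff function `f` and
of the noise. Round `t` selects a maximizer of the upper-confidence bound of `D_{t-1}`;
it is sampled and retained exactly if its conditional entropy exceeds `ε`. -/
def dictionary : ℕ → Dict 𝒳
  | 0 => []
  | t + 1 =>
    let D := dictionary t
    let x := argmax (t + 1) (ucb κ σ (beta (Fintype.card 𝒳) δ (t + 1)) D)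
    if ε < condEntropy κ σ D x then D ++ [(x, f x + noise (t + 1))] else D

/-- The action `x_t` selected in round `t ≥ 1`. -/
def action (t : ℕ) : 𝒳 :=
  argmax t (ucb κ σ (beta (Fintype.card 𝒳) δ t) (dictionary κ σ δ ε argmax f noise (t - 1)))

/-- The rounds `1 ≤ t ≤ T` in which the selected action is sampled and retained. -/
def updateTimes (T : ℕ) : Finset ℕ :=
  {t ∈ Finset.Icc 1 T | ε < condEntropy κ σ (dictionary κ σ δ ε argmax f noise (t - 1))
    (action κ σ δ ε argmax f noise t)}

/-- The regret accumulated up to `T` over the sampled actions. -/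
def regret (T : ℕ) : ℝ :=
  ∑ t ∈ updateTimes κ σ δ ε argmax f noise T,
    ((⨆ x, f x) - f (action κ σ δ ε argmax f noise t))

end Algorithm

/-- The Bayesian bandit model: `f` is a centred Gaussian process with covariance kernel `κ`, and
the noise variables are independent `N(0, σ²)` variables, independent of `f`. -/
structure IsModel {Ω : Type*} [MeasurableSpace Ω] (κ : 𝒳 → 𝒳 → ℝ) (σ : ℝ) (P : Measure Ω)
    (f : 𝒳 → Ω → ℝ) (noise : ℕ → Ω → ℝ) : Prop where
  gaussian : IsGaussianProcess f P
  mean_zero : ∀ x, ∫ ω, f x ω ∂P = 0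
  covariance : ∀ x x', cov[f x, f x'; P] = κ x x'
  noise_law : ∀ t, HasLaw (noise t) (gaussianReal 0 (σ ^ 2).toNNReal) P
  noise_indep : iIndepFun noise P
  indep : IndepFun (fun ω x => f x ω) (fun ω t => noise t ω) P

/-- `lim_{t → ∞} H(y_t) ≤ C`, where `y_t` is the vector of the observations that compressed GP-UCB
has retained up to time `t`; it holds along almost every sample path. -/
def FiniteEntropy [Fintype 𝒳] {Ω : Type*} [MeasurableSpace Ω] (κ : 𝒳 → 𝒳 → ℝ) (σ δ ε : ℝ)
    (argmax : ℕ → (𝒳 → ℝ) → 𝒳) (P : Measure Ω) (f : 𝒳 → Ω → ℝ) (noise : ℕ → Ω → ℝ)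
    (C : ℝ) : Prop :=
  ∀ᵐ ω ∂P, ∃ h ≤ C, Tendsto
    (fun t => obsEntropy κ σ (dictionary κ σ δ ε argmax (fun x => f x ω) (fun s => noise s ω) t))
    atTop (𝓝 h)

/-- The constant `C₁ = 8 / log (1 + σ⁻²)`. -/
def C₁ (σ : ℝ) : ℝ := 8 / Real.log (1 + (σ ^ 2)⁻¹)

/-- The constant `Z₁`: the trace of the kernel matrix on all actions over `σ² (1 - e⁻¹)`. -/
def Z₁ [Fintype 𝒳] (κ : 𝒳 → 𝒳 → ℝ) (σ : ℝ) : ℝ :=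
  (Matrix.of κ).trace / (σ ^ 2 * (1 - Real.exp (-1)))

end GPBandit

end

noncomputable section

namespace GPBandit

variable {𝒳 : Type*}

/-! Two facts carry the theorem: a confidence bound that survives the adaptive choice of samples,
and pathwise bounds on the number of samples and on the confidence widths.

Confidence. For a fixed list of actions and distinct sampling times, the error of the posterior mean
is Gaussian and uncorrelated with the observations, hence independent of them
(`IsModel.prob_residual_le`). The event that the algorithm retains exactly this list is determined
by those same observations (`measurableSet_retained_eq`), so the tail bound holds on each such
event. There are countably many lists, and summing over them gives `IsModel.prob_deviation_le`; a
union over actions and rounds costs at most `δ` by the choice of `beta`.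

Counting. By the chain rule each sample raises the entropy by more than `ε`, so at most `C / ε`
samples are ever taken (`card_updateTimes_le_div`).

Regret. On the confidence event a sampled action costs at most twice its confidence width. For (1)
the width is bounded by the prior standard deviation. For (2) this would leave a factor of order
`√(log T)`, so the decay of the posterior variance with repeated visits is used: the widths of `n`
samples sum to order `√n`. With `n ≤ √T` this is `T^(1/4)`, and `√β_T` is at most of the same order.
-/

/-! ### Posterior variance and entropy of a dictionary. -/

lemma noisyGram_posDef {κ : 𝒳 → 𝒳 → ℝ} {σ : ℝ} (hκ : (Matrix.of κ).PosSemidef)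
    (hσ : 0 < σ) (D : Dict 𝒳) : (noisyGram κ σ D).PosDef := by
  have h1 : (Matrix.of (fun i j : Fin D.length => κ (D.get i).1 (D.get j).1)).PosSemidef :=
    hκ.submatrix (fun i => (D.get i).1)
  exact Matrix.PosDef.posSemidef_add h1 (Matrix.PosDef.one.smul (pow_pos hσ 2))

/-- The posterior variance is the least mean square error among linear predictors. -/
lemma posteriorVar_le {κ : 𝒳 → 𝒳 → ℝ} {σ : ℝ} (hκ : (Matrix.of κ).PosSemidef)
    (hσ : 0 < σ) (D : Dict 𝒳) (x : 𝒳) (v : Fin D.length → ℝ) :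
    posteriorVar κ σ D x ≤
      κ x x - 2 * (v ⬝ᵥ kernelVec κ D x) + v ⬝ᵥ (noisyGram κ σ D *ᵥ v) := by
  have hG := noisyGram_posDef hκ hσ D
  unfold posteriorVar
  set G := noisyGram κ σ D
  set k := kernelVec κ D x
  set w := G⁻¹ *ᵥ k with hw
  have hGw : G *ᵥ w = k := by
    rw [hw, Matrix.mulVec_mulVec, Matrix.mul_nonsing_inv _ (G.isUnit_iff_isUnit_det.mp hG.isUnit),
      Matrix.one_mulVec]
  have hsymm : w ⬝ᵥ (G *ᵥ v) = v ⬝ᵥ k := by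
    have hT : Gᵀ = G := by simpa using hG.isHermitian.eq
    rw [Matrix.dotProduct_mulVec, ← Matrix.mulVec_transpose, hT, hGw, dotProduct_comm]
  -- Completing the square: the gap between the two sides is the quadratic form of `G` at `v - w`,
  -- with `w = G⁻¹ k` the optimal weights.
  have h := hG.posSemidef.dotProduct_mulVec_nonneg (v - w)
  simp only [star_trivial, Matrix.mulVec_sub, sub_dotProduct, dotProduct_sub, hGw, hsymm] at h
  rw [dotProduct_comm k w]
  linarith

lemma posteriorVar_le_prior {κ : 𝒳 → 𝒳 → ℝ} {σ : ℝ}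
    (hκ : (Matrix.of κ).PosSemidef) (hσ : 0 < σ) (D : Dict 𝒳) (x : 𝒳) :
    posteriorVar κ σ D x ≤ κ x x := by
  simpa using posteriorVar_le hκ hσ D x 0

/-- The number of retained observations of the action `x`. -/
def visits [DecidableEq 𝒳] (D : Dict 𝒳) (x : 𝒳) : ℕ := D.countP (fun p => p.1 = x)

lemma card_filter_get_eq_visits [DecidableEq 𝒳] (D : Dict 𝒳) (x : 𝒳) :
    (Finset.univ.filter (fun i : Fin D.length => (D.get i).1 = x)).card = visits D x := by
  unfold visits
  induction D with
  | nil => simp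
  | cons p D ih =>
    rw [List.countP_cons, ← ih, add_comm]
    have := Fin.card_filter_univ_succ (fun i : Fin (D.length + 1) => ((p :: D).get i).1 = x)
    simp only [List.length_cons]
    rw [this]
    by_cases h : p.1 = x <;> simp [h, add_comm]

/-- Compare with a suboptimal predictor: the sum of the `n` observations at `x` itself divided by `n
+ 1`, ignoring all others. Shrinking by `n + 1` rather than `n` also covers `n = 0`. -/
lemma posteriorVar_le_div [DecidableEq 𝒳] {κ : 𝒳 → 𝒳 → ℝ} {σ : ℝ}
    (hκ : (Matrix.of κ).PosSemidef) (hσ : 0 < σ) (D : Dict 𝒳) (x : 𝒳) :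
    posteriorVar κ σ D x ≤ (κ x x + σ ^ 2) / (visits D x + 1) := by
  have hκx : 0 ≤ κ x x := hκ.diag_nonneg (i := x)
  set S := Finset.univ.filter (fun i : Fin D.length => (D.get i).1 = x)
  set n : ℝ := (visits D x : ℝ) with hn
  have hnS : (S.card : ℝ) = n := by rw [hn, ← card_filter_get_eq_visits]
  have hn0 : 0 ≤ n := Nat.cast_nonneg _
  set v : Fin D.length → ℝ := fun i => if (D.get i).1 = x then (n + 1)⁻¹ else 0
  have h1 : v ⬝ᵥ kernelVec κ D x = n * (n + 1)⁻¹ * κ x x := by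
    have : ∀ i, v i * kernelVec κ D x i = if (D.get i).1 = x then (n + 1)⁻¹ * κ x x else 0 := by
      intro i
      by_cases hi : (D.get i).1 = x <;> simp only [v, kernelVec, hi, if_true, if_false, zero_mul]
    simp only [dotProduct, this]
    rw [← Finset.sum_filter, Finset.sum_const, nsmul_eq_mul, hnS, mul_assoc]
  have h2 : v ⬝ᵥ (noisyGram κ σ D *ᵥ v) =
      (n * (n + 1)⁻¹) ^ 2 * κ x x + σ ^ 2 * (n * (n + 1)⁻¹ ^ 2) := by
    have hv : v ⬝ᵥ v = n * (n + 1)⁻¹ ^ 2 := by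
      have : ∀ i, v i * v i = if (D.get i).1 = x then (n + 1)⁻¹ ^ 2 else 0 := by
        intro i
        by_cases hi : (D.get i).1 = x <;> simp only [v, hi, if_true, if_false, zero_mul, sq]
      simp only [dotProduct, this]
      rw [← Finset.sum_filter, Finset.sum_const, nsmul_eq_mul, hnS]
    have hK : v ⬝ᵥ (Matrix.of (fun i j => κ (D.get i).1 (D.get j).1) *ᵥ v) =
        (n * (n + 1)⁻¹) ^ 2 * κ x x := by
      have : ∀ i j, v i * (κ (D.get i).1 (D.get j).1 * v j) =
          (if (D.get i).1 = x then (n + 1)⁻¹ else 0) *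
          ((if (D.get j).1 = x then (n + 1)⁻¹ else 0) * κ x x) := by
        intro i j
        by_cases hi : (D.get i).1 = x
        · by_cases hj : (D.get j).1 = x
          · simp only [v, hi, hj, if_true]; ring
          · simp only [v, hj, if_false]; ring
        · simp only [v, hi, if_false]; ring
      simp only [dotProduct, Matrix.mulVec, Finset.mul_sum, Matrix.of_apply, this]
      simp only [← Finset.mul_sum, ← Finset.sum_mul]
      rw [← Finset.sum_filter, Finset.sum_const, nsmul_eq_mul, hnS]
      ring
    rw [noisyGram, Matrix.add_mulVec, dotProduct_add, hK, Matrix.smul_mulVec, Matrix.one_mulVec,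
      dotProduct_smul, hv, smul_eq_mul]
  refine (posteriorVar_le hκ hσ D x v).trans ?_
  rw [h1, h2]
  have hn1 : 0 < n + 1 := by positivity
  have : κ x x - 2 * (n * (n + 1)⁻¹ * κ x x) +
      ((n * (n + 1)⁻¹) ^ 2 * κ x x + σ ^ 2 * (n * (n + 1)⁻¹ ^ 2)) =
      (κ x x + σ ^ 2 * n) / (n + 1) ^ 2 := by
    field_simp
    ring
  rw [this, div_le_div_iff₀ (by positivity) hn1]
  nlinarith [mul_nonneg hn0 hκx, sq_nonneg σ, mul_nonneg (mul_nonneg hn0 hκx) hn1.le,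
    mul_nonneg hn1.le (sq_nonneg σ)]

/-- The new factor is the Schur complement of the old Gram matrix in the bordered one; this is the
chain rule for entropy before taking logarithms. -/
lemma det_noisyGram_append {κ : 𝒳 → 𝒳 → ℝ} {σ : ℝ}
    (hκ : (Matrix.of κ).PosSemidef) (hσ : 0 < σ) (D : Dict 𝒳) (x : 𝒳) (y : ℝ) :
    (noisyGram κ σ (D ++ [(x, y)])).det =
      (noisyGram κ σ D).det * (σ ^ 2 + posteriorVar κ σ D x) := by
  have hG := noisyGram_posDef hκ hσ D
  have hsymm : ∀ a b, κ a b = κ b a := fun a b => by simpa using (hκ.isHermitian.apply a b).symm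
  let e : Fin D.length ⊕ Fin 1 ≃ Fin (D ++ [(x, y)]).length :=
    finSumFinEquiv.trans (finCongr (by simp))
  have hl : ∀ i, ((D ++ [(x, y)]).get (e (Sum.inl i))) = D.get i := by
    intro i
    simp [e]
  have hr : ∀ i, ((D ++ [(x, y)]).get (e (Sum.inr i))) = (x, y) := by
    intro i
    simp [e]
  have : Invertible (noisyGram κ σ D) := hG.isUnit.invertible
  have hblock : (noisyGram κ σ (D ++ [(x, y)])).submatrix e e =
      Matrix.fromBlocks (noisyGram κ σ D) (Matrix.of fun i (_ : Fin 1) => kernelVec κ D x i)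
        (Matrix.of fun (_ : Fin 1) i => kernelVec κ D x i)
        (Matrix.of fun (_ _ : Fin 1) => κ x x + σ ^ 2) := by
    ext i j
    rcases i with i | i <;> rcases j with j | j <;>
      simp only [noisyGram, Matrix.submatrix_apply, Matrix.add_apply, Matrix.of_apply,
        Matrix.smul_apply, Matrix.one_apply, hl, hr, Matrix.fromBlocks_apply₁₁,
        Matrix.fromBlocks_apply₁₂, Matrix.fromBlocks_apply₂₁, Matrix.fromBlocks_apply₂₂,
        EmbeddingLike.apply_eq_iff_eq, Sum.inl.injEq, reduceCtorEq, if_false, kernelVec]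
    · simp
    · simp [hsymm]
    · simp [Subsingleton.elim i j]
  rw [← Matrix.det_submatrix_equiv_self e, hblock, Matrix.det_fromBlocks₁₁, Matrix.det_fin_one,
    Matrix.invOf_eq_nonsing_inv]
  congr 1
  simp only [posteriorVar, Matrix.sub_apply, Matrix.of_apply, Matrix.mul_assoc]
  have : ((Matrix.of fun (_ : Fin 1) i => kernelVec κ D x i) *
      ((noisyGram κ σ D)⁻¹ * Matrix.of fun i (_ : Fin 1) => kernelVec κ D x i)) 0 0 =
      kernelVec κ D x ⬝ᵥ ((noisyGram κ σ D)⁻¹ *ᵥ kernelVec κ D x) := by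
    simp [Matrix.mul_apply, dotProduct, Matrix.mulVec]
  rw [this]
  ring

lemma obsEntropy_nil (κ : 𝒳 → 𝒳 → ℝ) (σ : ℝ) : obsEntropy κ σ [] = 0 := by
  have : ∀ S : Matrix (Fin 0) (Fin 0) ℝ, gaussianEntropy S = 0 := by
    intro S; simp [gaussianEntropy]
  exact this _

/-- The chain rule for the entropy of the retained observations. -/
lemma obsEntropy_append {κ : 𝒳 → 𝒳 → ℝ} {σ : ℝ}
    (hκ : (Matrix.of κ).PosSemidef) (hσ : 0 < σ) (D : Dict 𝒳) (x : 𝒳) (y : ℝ) :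
    obsEntropy κ σ (D ++ [(x, y)]) = obsEntropy κ σ D + condEntropy κ σ D x := by
  have h1 := (noisyGram_posDef hκ hσ D).det_pos
  have h2 := (noisyGram_posDef hκ hσ (D ++ [(x, y)])).det_pos
  have h3 := det_noisyGram_append hκ hσ D x y
  rw [h3] at h2
  have h4 : 0 < σ ^ 2 + posteriorVar κ σ D x := pos_of_mul_pos_right h2 h1.le
  have hc : 0 < 2 * Real.pi * Real.exp 1 := by positivity
  simp only [obsEntropy, gaussianEntropy, condEntropy, Matrix.det_smul, h3, Fintype.card_fin]
  rw [← mul_add, ← Real.log_mul (by positivity) (by positivity)]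
  congr 2
  rw [List.length_append, List.length_singleton, pow_succ]
  ring

/-! ### Gaussian tails. -/

/-- Translate by `c` and use `(x + c)² ≥ x² + c²` for `x, c ≥ 0`. Keeping the mass of the half-line,
which is at most `1/2`, is what saves the factor `2` in the two-sided bound. -/
lemma gaussianReal_Ioi_le (v : NNReal) (hv : v ≠ 0) {c : ℝ} (hc : 0 ≤ c) :
    gaussianReal 0 v (Set.Ioi c) ≤
      ENNReal.ofReal (Real.exp (-(c ^ 2) / (2 * v))) * gaussianReal 0 v (Set.Ioi 0) := by
  have hv0 : (0 : ℝ) < v := by positivity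
  rw [gaussianReal_apply _ hv, gaussianReal_apply _ hv,
    ← lintegral_const_mul _ (measurable_gaussianPDF _ _),
    ← lintegral_indicator measurableSet_Ioi, ← lintegral_indicator measurableSet_Ioi,
    ← lintegral_add_right_eq_self _ c]
  refine lintegral_mono fun x => ?_
  by_cases hx : 0 < x
  · have h1 : x + c ∈ Set.Ioi c := by simpa using hx
    have h2 : x ∈ Set.Ioi (0 : ℝ) := hx
    rw [Set.indicator_of_mem h1, Set.indicator_of_mem h2, gaussianPDF, gaussianPDF,
      ← ENNReal.ofReal_mul (Real.exp_pos _).le]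
    refine ENNReal.ofReal_le_ofReal ?_
    simp only [gaussianPDFReal]
    rw [mul_left_comm, ← Real.exp_add]
    refine mul_le_mul_of_nonneg_left (Real.exp_le_exp.2 ?_) (by positivity)
    rw [← add_div]
    gcongr
    nlinarith [mul_nonneg hx.le hc]
  · have h1 : x + c ∉ Set.Ioi c := by simpa using hx
    rw [Set.indicator_of_notMem h1]
    exact zero_le

lemma gaussianReal_Iio_neg (v : NNReal) (c : ℝ) :
    gaussianReal 0 v (Set.Iio (-c)) = gaussianReal 0 v (Set.Ioi c) := by
  have h := gaussianReal_map_neg (μ := 0) (v := v)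
  rw [neg_zero] at h
  rw [← h, Measure.map_apply measurable_neg measurableSet_Iio, h]
  congr 1
  ext x
  simp

/-- The two-sided tail bound for a centred Gaussian law, without the factor `2` of the Chernoff
bound. -/
lemma gaussianReal_abs_tail_le (v : ℝ) {b : ℝ} (hb : 0 ≤ b) :
    gaussianReal 0 v.toNNReal {x | √b * √v < |x|} ≤ ENNReal.ofReal (Real.exp (-b / 2)) := by
  -- For `v ≤ 0` both `toNNReal` and the square root return `0`: the law is a point mass at `0`, and
  -- the tail event misses it.
  rcases le_or_gt v 0 with hv | hv
  · rw [Real.toNNReal_of_nonpos hv, gaussianReal_zero_var, Real.sqrt_eq_zero_of_nonpos hv,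
      Measure.dirac_apply' _ (measurableSet_lt (by fun_prop) (by fun_prop))]
    simp
  · have hv' : v.toNNReal ≠ 0 := by simpa using hv
    set c := √b * √v with hc
    have hc0 : 0 ≤ c := by positivity
    have hset : {x : ℝ | c < |x|} = Set.Ioi c ∪ Set.Iio (-c) := by
      ext x
      simp only [Set.mem_ofPred_eq, Set.mem_union, Set.mem_Ioi, Set.mem_Iio, lt_abs]
      refine or_congr Iff.rfl ⟨fun h => by linarith, fun h => by linarith⟩
    have hexp : -(c ^ 2) / (2 * (v.toNNReal : ℝ)) = -b / 2 := by
      rw [hc, mul_pow, Real.sq_sqrt hb, Real.sq_sqrt hv.le, Real.coe_toNNReal _ hv.le]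
      field_simp
    have h1 := gaussianReal_Ioi_le v.toNNReal hv' hc0
    rw [hexp] at h1
    have h0 : gaussianReal 0 v.toNNReal (Set.Ioi 0) + gaussianReal 0 v.toNNReal (Set.Iio 0) ≤ 1 := by
      have hdisj : Disjoint (Set.Ioi (0 : ℝ)) (Set.Iio 0) :=
        Set.disjoint_left.2 fun x hx hx' => lt_asymm (Set.mem_Ioi.1 hx) (Set.mem_Iio.1 hx')
      rw [← measure_union hdisj measurableSet_Iio]
      exact prob_le_one
    have h00 := gaussianReal_Iio_neg v.toNNReal 0
    rw [neg_zero] at h00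
    rw [h00] at h0
    calc gaussianReal 0 v.toNNReal {x | c < |x|}
        ≤ gaussianReal 0 v.toNNReal (Set.Ioi c) + gaussianReal 0 v.toNNReal (Set.Iio (-c)) := by
          rw [hset]; exact measure_union_le _ _
      _ ≤ ENNReal.ofReal (Real.exp (-b / 2)) *
          (gaussianReal 0 v.toNNReal (Set.Ioi 0) + gaussianReal 0 v.toNNReal (Set.Ioi 0)) := by
          rw [gaussianReal_Iio_neg, mul_add]; exact add_le_add h1 h1
      _ ≤ ENNReal.ofReal (Real.exp (-b / 2)) := mul_le_of_le_one_right' h0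

/-! ### The Gaussian model observed along a fixed design. -/

section Model

variable {Ω : Type*} [MeasurableSpace Ω] {κ : 𝒳 → 𝒳 → ℝ} {σ : ℝ} {P : Measure Ω}
  {f : 𝒳 → Ω → ℝ} {noise : ℕ → Ω → ℝ}

lemma IsModel.memLp_payoff (h : IsModel κ σ P f noise) (x : 𝒳) : MemLp (f x) 2 P :=
  (h.gaussian.hasGaussianLaw_eval x).memLp_two

lemma IsModel.memLp_noise (h : IsModel κ σ P f noise) (t : ℕ) : MemLp (noise t) 2 P :=
  (h.noise_law t).hasGaussianLaw.memLp_two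

lemma IsModel.kernel_symm (h : IsModel κ σ P f noise) (x x' : 𝒳) : κ x x' = κ x' x := by
  rw [← h.covariance, ← h.covariance, covariance_comm]

lemma IsModel.covariance_noise (h : IsModel κ σ P f noise) (s t : ℕ) :
    cov[noise s, noise t; P] = if s = t then σ ^ 2 else 0 := by
  split_ifs with hst
  · subst hst
    rw [covariance_self (h.memLp_noise s).aemeasurable, (h.noise_law s).variance_eq,
      variance_id_gaussianReal, Real.coe_toNNReal _ (sq_nonneg σ)]
  · exact (h.noise_indep.indepFun hst).covariance_eq_zero (h.memLp_noise s) (h.memLp_noise t)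

lemma IsModel.covariance_payoff_noise (h : IsModel κ σ P f noise) (x : 𝒳) (t : ℕ) :
    cov[f x, noise t; P] = 0 :=
  (h.indep.comp (measurable_pi_apply x) (measurable_pi_apply t)).covariance_eq_zero
    (h.memLp_payoff x) (h.memLp_noise t)

variable [Fintype 𝒳]

lemma IsModel.hasGaussianLaw_payoff (h : IsModel κ σ P f noise) :
    HasGaussianLaw (fun ω x => f x ω) P := by
  let L : (↥(Finset.univ : Finset 𝒳) → ℝ) →L[ℝ] (𝒳 → ℝ) :=
    ContinuousLinearMap.pi fun x => .proj ⟨x, Finset.mem_univ x⟩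
  exact (h.gaussian.hasGaussianLaw Finset.univ).map L

lemma IsModel.hasGaussianLaw_prod (h : IsModel κ σ P f noise) {n : ℕ} {τ : Fin n → ℕ}
    (hτ : Function.Injective τ) :
    HasGaussianLaw (fun ω => ((fun x => f x ω), (fun i => noise (τ i) ω))) P := by
  refine IndepFun.hasGaussianLaw h.hasGaussianLaw_payoff
    (iIndepFun.hasGaussianLaw (fun i => (h.noise_law (τ i)).hasGaussianLaw)
      (h.noise_indep.precomp hτ)) ?_
  exact h.indep.comp measurable_id (measurable_pi_lambda _ fun i => measurable_pi_apply (τ i))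

variable [IsProbabilityMeasure P]

lemma IsModel.posSemidef (h : IsModel κ σ P f noise) : (Matrix.of κ).PosSemidef := by
  refine Matrix.PosSemidef.of_dotProduct_mulVec_nonneg ?_ fun v => ?_
  · ext i j
    simp [h.kernel_symm i j]
  · have hv : star v ⬝ᵥ (Matrix.of κ *ᵥ v) = Var[fun ω => ∑ i, v i * f i ω; P] := by
      rw [← covariance_self
        (memLp_finsetSum _ fun i _ => (h.memLp_payoff i).const_mul (v i)).aemeasurable,
        covariance_fun_sum_fun_sum (fun i => (h.memLp_payoff i).const_mul (v i))
          (fun i => (h.memLp_payoff i).const_mul (v i))]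
      simp only [covariance_const_mul_left, covariance_const_mul_right, h.covariance, dotProduct,
        Matrix.mulVec, Matrix.of_apply, star_trivial, Finset.mul_sum]
      exact Finset.sum_congr rfl fun i _ => Finset.sum_congr rfl fun j _ => by ring
    rw [hv]
    exact variance_nonneg _ _

/-- The normal equations `hw` make the residual uncorrelated with every observation; joint
Gaussianity turns this into independence. The arbitrary event `B` of the observations will be the
event that the algorithm follows this design. -/
lemma IsModel.prob_residual_le (h : IsModel κ σ P f noise) {n : ℕ} (a : Fin n → 𝒳)
    {τ : Fin n → ℕ} (hτ : Function.Injective τ) (x : 𝒳) (w : Fin n → ℝ)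
    (hw : ∀ j, ∑ i, w i * κ (a i) (a j) + σ ^ 2 * w j = κ (a j) x)
    {B : Set (Fin n → ℝ)} (hB : MeasurableSet B) {b : ℝ} (hb : 0 ≤ b) :
    P ({ω | (fun i => f (a i) ω + noise (τ i) ω) ∈ B} ∩
        {ω | √b * √(κ x x - ∑ i, w i * κ (a i) x) <
          |f x ω - ∑ i, w i * (f (a i) ω + noise (τ i) ω)|}) ≤
      P {ω | (fun i => f (a i) ω + noise (τ i) ω) ∈ B} *
        ENNReal.ofReal (Real.exp (-b / 2)) := by
  set Y : Fin n → Ω → ℝ := fun i ω => f (a i) ω + noise (τ i) ω with hY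
  set R : Ω → ℝ := fun ω => f x ω - ∑ i, w i * Y i ω with hR
  have hgauss : HasGaussianLaw (fun ω => ((fun _ : Unit => R ω), fun i => Y i ω)) P := by
    let LY : (𝒳 → ℝ) × (Fin n → ℝ) →L[ℝ] (Fin n → ℝ) := ContinuousLinearMap.pi fun i =>
      (ContinuousLinearMap.proj (R := ℝ) (φ := fun _ : 𝒳 => ℝ) (a i)).comp (.fst ℝ _ _) +
        (ContinuousLinearMap.proj (R := ℝ) (φ := fun _ : Fin n => ℝ) i).comp (.snd ℝ _ _)
    let LR : (𝒳 → ℝ) × (Fin n → ℝ) →L[ℝ] (Unit → ℝ) := ContinuousLinearMap.pi fun _ =>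
      (ContinuousLinearMap.proj (R := ℝ) (φ := fun _ : 𝒳 => ℝ) x).comp (.fst ℝ _ _) -
        ∑ i, w i • (ContinuousLinearMap.proj (R := ℝ) (φ := fun _ : Fin n => ℝ) i).comp LY
    have := (h.hasGaussianLaw_prod hτ).map (LR.prod LY)
    convert! this using 1
    funext ω
    simp [LR, LY, hR, hY, mul_add]
  have hYL : ∀ i, MemLp (Y i) 2 P := fun i => (h.memLp_payoff _).add (h.memLp_noise _)
  have hwYL : ∀ i, MemLp (fun ω => w i * Y i ω) 2 P := fun i => (hYL i).const_mul _
  have hsL : MemLp (fun ω => ∑ i, w i * Y i ω) 2 P := memLp_finsetSum _ fun i _ => hwYL i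
  have hRL : MemLp R 2 P := (h.memLp_payoff x).sub hsL
  have hfY : ∀ z j, cov[f z, Y j; P] = κ z (a j) := by
    intro z j
    change cov[f z, f (a j) + noise (τ j); P] = _
    rw [covariance_add_right (h.memLp_payoff z) (h.memLp_payoff _) (h.memLp_noise _),
      h.covariance, h.covariance_payoff_noise, add_zero]
  have hNY : ∀ i j, cov[noise (τ i), Y j; P] = if i = j then σ ^ 2 else 0 := by
    intro i j
    change cov[noise (τ i), f (a j) + noise (τ j); P] = _
    rw [covariance_add_right (h.memLp_noise _) (h.memLp_payoff _) (h.memLp_noise _),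
      covariance_comm, h.covariance_payoff_noise, zero_add, h.covariance_noise]
    simp only [hτ.eq_iff]
  have hYY : ∀ i j, cov[Y i, Y j; P] = κ (a i) (a j) + if i = j then σ ^ 2 else 0 := by
    intro i j
    rw [show Y i = f (a i) + noise (τ i) from rfl,
      covariance_add_left (h.memLp_payoff _) (h.memLp_noise _) (hYL j), hfY, hNY]
  have hRY : ∀ j, cov[R, Y j; P] = 0 := by
    intro j
    rw [hR, covariance_fun_sub_left (h.memLp_payoff x) hsL (hYL j), hfY,
      covariance_fun_sum_left hwYL (hYL j)]
    simp only [covariance_const_mul_left, hYY, mul_add, Finset.sum_add_distrib]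
    rw [h.kernel_symm x, ← hw j]
    simp [mul_comm]
  -- Since `R` is orthogonal to the observations, its variance reduces to its covariance with `f x`.
  have hvar : Var[R; P] = κ x x - ∑ i, w i * κ (a i) x := by
    rw [← covariance_self hRL.aemeasurable]
    have h1 : cov[R, R; P] = cov[R, f x; P] - cov[R, fun ω => ∑ i, w i * Y i ω; P] :=
      covariance_fun_sub_right hRL (h.memLp_payoff x) hsL
    have h2 : cov[R, fun ω => ∑ i, w i * Y i ω; P] = 0 := by
      rw [covariance_fun_sum_right hwYL hRL]
      simp [covariance_const_mul_right, hRY]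
    have h3 : cov[R, f x; P] = κ x x - ∑ i, w i * κ (a i) x := by
      rw [hR, covariance_fun_sub_left (h.memLp_payoff x) hsL (h.memLp_payoff x), h.covariance,
        covariance_fun_sum_left hwYL (h.memLp_payoff x)]
      simp only [covariance_const_mul_left]
      congr 1
      exact Finset.sum_congr rfl fun i _ => by rw [covariance_comm, hfY, h.kernel_symm]
    rw [h1, h2, h3, sub_zero]
  have hmeanY : ∀ i, ∫ ω, Y i ω ∂P = 0 := by
    intro i
    rw [hY, integral_add ((h.memLp_payoff _).integrable one_le_two)
      ((h.memLp_noise _).integrable one_le_two), h.mean_zero, (h.noise_law _).integral_eq]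
    simp
  have hmean : ∫ ω, R ω ∂P = 0 := by
    rw [hR, integral_sub ((h.memLp_payoff _).integrable one_le_two)
      (hsL.integrable one_le_two), h.mean_zero,
      integral_finsetSum _ fun i _ => (hwYL i).integrable one_le_two]
    simp [integral_const_mul, hmeanY]
  have hRG : HasGaussianLaw R P := hgauss.fst.eval ()
  have hindep : IndepFun (fun ω => fun _ : Unit => R ω) (fun ω i => Y i ω) P :=
    hgauss.indepFun_of_covariance_eval fun _ j => hRY j
  have hindep' : IndepFun (fun ω i => Y i ω) R P :=
    (hindep.symm).comp measurable_id (measurable_pi_apply ())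
  set c := √b * √(κ x x - ∑ i, w i * κ (a i) x)
  have hcm : MeasurableSet {r : ℝ | c < |r|} := measurableSet_lt (by fun_prop) (by fun_prop)
  have hmul := hindep'.measure_inter_preimage_eq_mul _ _ hB hcm
  have htail : P (R ⁻¹' {r | c < |r|}) ≤ ENNReal.ofReal (Real.exp (-b / 2)) := by
    rw [← Measure.map_apply_of_aemeasurable hRG.aemeasurable hcm, hRG.map_eq_gaussianReal, hmean,
      hvar]
    exact gaussianReal_abs_tail_le _ hb
  exact hmul.le.trans (by gcongr; rfl)

end Model

/-! ### Observations along a list of actions and times. -/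

/-- The dictionary of observations taken at prescribed actions and times. -/
def observe (f : 𝒳 → ℝ) (noise : ℕ → ℝ) (p : List (𝒳 × ℕ)) : Dict 𝒳 :=
  p.map fun q => (q.1, f q.1 + noise q.2)

section Weights

variable {κ : 𝒳 → 𝒳 → ℝ} {σ : ℝ}

/-- An observed list has the length of its design only up to a propositional equality, so the index
type of the matrices has to be transported. -/
lemma posterior_eq_of_length_eq (D : Dict 𝒳) {n : ℕ} (h : D.length = n) (a : Fin n → 𝒳)
    (y : Fin n → ℝ) (ha : ∀ i : Fin D.length, D.get i = (a (i.cast h), y (i.cast h))) (x : 𝒳) :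
    let G := Matrix.of (fun i j => κ (a i) (a j)) + σ ^ 2 • (1 : Matrix (Fin n) (Fin n) ℝ)
    let k := fun i => κ (a i) x
    posteriorMean κ σ D x = k ⬝ᵥ (G⁻¹ *ᵥ y) ∧
      posteriorVar κ σ D x = κ x x - k ⬝ᵥ (G⁻¹ *ᵥ k) := by
  subst h
  obtain rfl : a = fun i => (D.get i).1 := funext fun i => by rw [ha i]; rfl
  obtain rfl : y = fun i => (D.get i).2 := funext fun i => by rw [ha i]; rfl
  exact ⟨rfl, rfl⟩

/-- The posterior mean is the linear predictor whose weights solve the normal equations. -/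
lemma exists_weights (hκ : (Matrix.of κ).PosSemidef) (hσ : 0 < σ) (p : List (𝒳 × ℕ)) (x : 𝒳) :
    ∃ w : Fin p.length → ℝ,
      (∀ f noise, posteriorMean κ σ (observe f noise p) x =
        ∑ i, w i * (f (p.get i).1 + noise (p.get i).2)) ∧
      (∀ f noise, posteriorVar κ σ (observe f noise p) x =
        κ x x - ∑ i, w i * κ (p.get i).1 x) ∧
      ∀ j, ∑ i, w i * κ (p.get i).1 (p.get j).1 + σ ^ 2 * w j = κ (p.get j).1 x := by
  set a : Fin p.length → 𝒳 := fun i => (p.get i).1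
  set G := Matrix.of (fun i j => κ (a i) (a j)) +
    σ ^ 2 • (1 : Matrix (Fin p.length) (Fin p.length) ℝ) with hG
  set k : Fin p.length → ℝ := fun i => κ (a i) x with hk
  have hsymm : ∀ a b, κ a b = κ b a := fun a b => by simpa using (hκ.isHermitian.apply a b).symm
  have hGpos : G.PosDef :=
    Matrix.PosDef.posSemidef_add (hκ.submatrix a) (Matrix.PosDef.one.smul (pow_pos hσ 2))
  have hGT : Gᵀ = G := by simpa using hGpos.isHermitian.eq
  have hGw : G *ᵥ (G⁻¹ *ᵥ k) = k := by
    rw [Matrix.mulVec_mulVec, Matrix.mul_nonsing_inv _ (G.isUnit_iff_isUnit_det.mp hGpos.isUnit),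
      Matrix.one_mulVec]
  have hdot : ∀ y, k ⬝ᵥ (G⁻¹ *ᵥ y) = ∑ i, (G⁻¹ *ᵥ k) i * y i := by
    intro y
    rw [Matrix.dotProduct_mulVec, ← Matrix.mulVec_transpose, Matrix.transpose_nonsing_inv, hGT]
    rfl
  have hpost : ∀ f noise, _ := fun f noise =>
    posterior_eq_of_length_eq (κ := κ) (σ := σ) (observe f noise p) (by simp [observe]) a
      (fun i => f (p.get i).1 + noise (p.get i).2) (fun i => List.getElem_map _) x
  refine ⟨G⁻¹ *ᵥ k, fun f noise => ?_, fun f noise => ?_, fun j => ?_⟩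
  · rw [(hpost f noise).1, hdot]
  · rw [(hpost f noise).2, hdot]
  · have := congrFun hGw j
    rw [hG, Matrix.add_mulVec, ← hG, Matrix.smul_mulVec, Matrix.one_mulVec] at this
    simp only [Pi.add_apply, Pi.smul_apply, smul_eq_mul, hk] at this
    rw [← this]
    congr 1
    simp only [Matrix.mulVec, dotProduct, Matrix.of_apply]
    exact Finset.sum_congr rfl fun i _ => by rw [hsymm, mul_comm]

/-- The posterior variance ignores the observed values, so for a given design and action the
sampling decision is deterministic. -/
lemma condEntropy_observe (hκ : (Matrix.of κ).PosSemidef) (hσ : 0 < σ) (p : List (𝒳 × ℕ)) (x : 𝒳)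
    (f f' : 𝒳 → ℝ) (noise noise' : ℕ → ℝ) :
    condEntropy κ σ (observe f noise p) x = condEntropy κ σ (observe f' noise' p) x := by
  obtain ⟨w, -, hv, -⟩ := exists_weights hκ hσ p x
  simp only [condEntropy, hv]

end Weights

section Retained

variable [Fintype 𝒳] (κ : 𝒳 → 𝒳 → ℝ) (σ δ ε : ℝ) (argmax : ℕ → (𝒳 → ℝ) → 𝒳)
  (f : 𝒳 → ℝ) (noise : ℕ → ℝ)

lemma dictionary_succ (t : ℕ) :
    dictionary κ σ δ ε argmax f noise (t + 1) =
      if ε < condEntropy κ σ (dictionary κ σ δ ε argmax f noise t)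
          (action κ σ δ ε argmax f noise (t + 1))
      then dictionary κ σ δ ε argmax f noise t ++
        [(action κ σ δ ε argmax f noise (t + 1),
          f (action κ σ δ ε argmax f noise (t + 1)) + noise (t + 1))]
      else dictionary κ σ δ ε argmax f noise t := rfl

/-- The retained actions up to time `t`, with the rounds in which they were sampled. -/
def retained : ℕ → List (𝒳 × ℕ)
  | 0 => []
  | t + 1 =>
    if ε < condEntropy κ σ (dictionary κ σ δ ε argmax f noise t)
        (action κ σ δ ε argmax f noise (t + 1))
    then retained t ++ [(action κ σ δ ε argmax f noise (t + 1), t + 1)] else retained t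

/-- Dictionaries contain real values, whereas `retained` ranges over a countable type; this identity
allows a split over its values. -/
lemma observe_retained (t : ℕ) :
    observe f noise (retained κ σ δ ε argmax f noise t) =
      dictionary κ σ δ ε argmax f noise t := by
  induction t with
  | zero => rfl
  | succ t ih =>
    rw [retained, dictionary_succ]
    split_ifs
    · rw [← ih]; simp [observe]
    · exact ih

/-- Distinct times mean distinct, hence independent, noise variables; the upper bound on the times
keeps the induction going. -/
lemma retained_times (t : ℕ) :
    ((retained κ σ δ ε argmax f noise t).map Prod.snd).Nodup ∧
      ∀ q ∈ retained κ σ δ ε argmax f noise t, q.2 ≤ t := by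
  induction t with
  | zero => simp [retained]
  | succ t ih =>
    rw [retained]
    split_ifs
    · refine ⟨?_, ?_⟩
      · rw [List.map_append, List.nodup_append]
        refine ⟨ih.1, by simp, ?_⟩
        simp only [List.mem_map, List.map_cons, List.map_nil, List.mem_singleton]
        rintro s ⟨q, hq, rfl⟩ s' rfl hs
        have := ih.2 q hq
        omega
      · simp only [List.mem_append, List.mem_singleton]
        rintro q (hq | rfl)
        · exact (ih.2 q hq).trans (Nat.le_succ t)
        · exact le_rfl
    · exact ⟨ih.1, fun q hq => (ih.2 q hq).trans (Nat.le_succ t)⟩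

end Retained

/-! ### The retained list is determined by its own observations. -/

section PathMeasurability

variable {Ω : Type*} (f : 𝒳 → Ω → ℝ) (noise : ℕ → Ω → ℝ)

/-- The observations along a fixed list of actions and times. -/
def obsVec (p : List (𝒳 × ℕ)) (ω : Ω) : Fin p.length → ℝ :=
  fun i => f (p.get i).1 ω + noise (p.get i).2 ω

/-- The information carried by the observations along a fixed list of actions and times. -/
abbrev obsSigma (p : List (𝒳 × ℕ)) : MeasurableSpace Ω :=
  MeasurableSpace.comap (obsVec f noise p) inferInstance

lemma measurable_obsVec_apply (p : List (𝒳 × ℕ)) (i : Fin p.length) :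
    Measurable[obsSigma f noise p] fun ω => f (p.get i).1 ω + noise (p.get i).2 ω :=
  (measurable_pi_apply i).comp (comap_measurable (obsVec f noise p))

lemma obsSigma_le_append (p : List (𝒳 × ℕ)) (r : 𝒳 × ℕ) :
    obsSigma f noise p ≤ obsSigma f noise (p ++ [r]) := by
  rw [obsSigma, ← measurable_iff_comap_le]
  refine @measurable_pi_lambda _ _ _ (_) _ _ fun i => ?_
  have h := measurable_obsVec_apply f noise (p ++ [r])
    ⟨i, by rw [List.length_append]; exact i.2.trans_le (Nat.le_add_right _ _)⟩
  simpa [obsVec] using h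

variable {κ : 𝒳 → 𝒳 → ℝ} {σ : ℝ} (δ ε : ℝ) {argmax : ℕ → (𝒳 → ℝ) → 𝒳}

/-- For a fixed design the mean is linear in the observations and the width is constant. -/
lemma measurable_ucb_observe (hκ : (Matrix.of κ).PosSemidef) (hσ : 0 < σ) (b : ℝ)
    (p : List (𝒳 × ℕ)) :
    Measurable[obsSigma f noise p] fun ω =>
      ucb κ σ b (observe (fun x => f x ω) (fun t => noise t ω) p) := by
  refine @measurable_pi_lambda _ _ _ (_) _ _ fun x => ?_
  obtain ⟨w, hm, hv, -⟩ := exists_weights hκ hσ p x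
  simp only [ucb, hm, hv]
  refine Measurable.add_const ?_ _
  exact Finset.measurable_fun_sum _ fun i _ => (measurable_obsVec_apply f noise p i).const_mul _

variable [Fintype 𝒳]

lemma measurableSet_argmax_observe (hκ : (Matrix.of κ).PosSemidef) (hσ : 0 < σ)
    (hA : IsArgmaxRule argmax) (t : ℕ) (b : ℝ) (p : List (𝒳 × ℕ)) (Q : 𝒳 → Prop) :
    MeasurableSet[obsSigma f noise p] {ω | Q (argmax t
      (ucb κ σ b (observe (fun x => f x ω) (fun t => noise t ω) p)))} := by
  have h : {ω | Q (argmax t (ucb κ σ b (observe (fun x => f x ω) (fun t => noise t ω) p)))} =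
      ⋃ a ∈ {a | Q a}, (fun ω => ucb κ σ b (observe (fun x => f x ω) (fun t => noise t ω) p)) ⁻¹'
        {g | argmax t g = a} := by
    ext ω
    simp
  rw [h]
  exact MeasurableSet.biUnion (Set.to_countable _) fun a _ =>
    measurable_ucb_observe f noise hκ hσ b p (hA.measurable t a)

/-- Which actions are retained, and when, is decided by the retained observations alone. -/
lemma measurableSet_retained_eq (hκ : (Matrix.of κ).PosSemidef) (hσ : 0 < σ)
    (hA : IsArgmaxRule argmax) (t : ℕ) (p : List (𝒳 × ℕ)) :
    MeasurableSet[obsSigma f noise p]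
      {ω | retained κ σ δ ε argmax (fun x => f x ω) (fun s => noise s ω) t = p} := by
  induction t generalizing p with
  | zero => exact @MeasurableSet.const _ (obsSigma f noise p) ([] = p)
  | succ t ih =>
    set e : List (𝒳 × ℕ) → 𝒳 → ℝ := fun q x => condEntropy κ σ (observe 0 0 q) x with he
    set act : List (𝒳 × ℕ) → Ω → 𝒳 := fun q ω => argmax (t + 1)
      (ucb κ σ (beta (Fintype.card 𝒳) δ (t + 1))
        (observe (fun x => f x ω) (fun t => noise t ω) q)) with hact
    set R : Ω → List (𝒳 × ℕ) := fun ω =>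
      retained κ σ δ ε argmax (fun x => f x ω) (fun s => noise s ω) t with hR
    have hstep : ∀ ω, retained κ σ δ ε argmax (fun x => f x ω) (fun s => noise s ω) (t + 1) =
        if ε < e (R ω) (act (R ω) ω) then R ω ++ [(act (R ω) ω, t + 1)] else R ω := by
      intro ω
      have h1 : action κ σ δ ε argmax (fun x => f x ω) (fun s => noise s ω) (t + 1) =
          act (R ω) ω := by
        simp only [hact, hR, observe_retained]
        rfl
      rw [retained, h1, ← observe_retained, he]
      simp only [condEntropy_observe hκ hσ _ _ 0 (fun x => f x ω) 0 (fun s => noise s ω)]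
      rfl
    have hstay : MeasurableSet[obsSigma f noise p] {ω | R ω = p ∧ ¬ ε < e p (act p ω)} :=
      MeasurableSet.inter (ih p)
        (measurableSet_argmax_observe f noise hκ hσ hA (t + 1) _ p fun x => ¬ ε < e p x)
    simp only [hstep]
    -- The list equals `p` after the next round in two ways: it was `p` and no sample was taken, or
    -- `p = q ++ [r]`, it was `q`, and `r` was added. The second event depends only on the
    -- observations along `q`, a coarser σ-algebra.
    rcases List.eq_nil_or_concat' p with rfl | ⟨q, r, rfl⟩
    · convert hstay using 1
      ext ω
      simp only [Set.mem_ofPred_eq]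
      constructor
      · intro h
        split_ifs at h with hc
        · simp at h
        · exact ⟨h, h ▸ hc⟩
      · rintro ⟨h, hc⟩
        rw [h, if_neg hc]
    · have hmove : MeasurableSet[obsSigma f noise (q ++ [r])]
          {ω | R ω = q ∧ (ε < e q (act q ω) ∧ (act q ω, t + 1) = r)} :=
        obsSigma_le_append f noise q r _ (MeasurableSet.inter (ih q)
          (measurableSet_argmax_observe f noise hκ hσ hA (t + 1) _ q
            fun x => ε < e q x ∧ (x, t + 1) = r))
      convert hstay.union hmove using 1
      ext ω
      simp only [Set.mem_ofPred_eq, Set.mem_union]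
      constructor
      · intro h
        split_ifs at h with hc
        · obtain ⟨h1, h2⟩ := List.append_inj' h rfl
          rw [h1] at hc h2
          exact Or.inr ⟨h1, hc, by simpa using h2⟩
        · exact Or.inl ⟨h, h ▸ hc⟩
      · rintro (⟨h, hc⟩ | ⟨h, hc, h2⟩)
        · rw [h, if_neg hc]
        · rw [h, if_pos hc, h2]

end PathMeasurability

/-! ### The exploration parameter. -/

section Beta

lemma beta_arg_pos {X : ℕ} (hX : 0 < X) {δ : ℝ} (hδ₀ : 0 < δ) {t : ℕ} (ht : 1 ≤ t) :
    0 < X * (t : ℝ) ^ 2 * Real.pi ^ 2 / (6 * δ) := by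
  have : (0 : ℝ) < t := by exact_mod_cast ht
  positivity

lemma one_le_beta_arg {X : ℕ} (hX : 0 < X) {δ : ℝ} (hδ₀ : 0 < δ) (hδ₁ : δ < 1) {t : ℕ}
    (ht : 1 ≤ t) : 1 ≤ X * (t : ℝ) ^ 2 * Real.pi ^ 2 / (6 * δ) := by
  have hX' : (1 : ℝ) ≤ X := by exact_mod_cast hX
  have ht' : (1 : ℝ) ≤ (t : ℝ) ^ 2 := one_le_pow₀ (by exact_mod_cast ht)
  have hpi : 6 ≤ Real.pi ^ 2 := by nlinarith [Real.pi_gt_three]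
  rw [le_div_iff₀ (by positivity)]
  have h1 : 1 ≤ X * (t : ℝ) ^ 2 := one_le_mul_of_one_le_of_one_le hX' ht'
  nlinarith

lemma beta_nonneg {X : ℕ} (hX : 0 < X) {δ : ℝ} (hδ₀ : 0 < δ) (hδ₁ : δ < 1) {t : ℕ}
    (ht : 1 ≤ t) : 0 ≤ beta X δ t :=
  mul_nonneg two_pos.le (Real.log_nonneg (one_le_beta_arg hX hδ₀ hδ₁ ht))

lemma beta_mono {X : ℕ} (hX : 0 < X) {δ : ℝ} (hδ₀ : 0 < δ) {s t : ℕ} (hs : 1 ≤ s)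
    (hst : s ≤ t) : beta X δ s ≤ beta X δ t := by
  have := beta_arg_pos hX hδ₀ hs
  unfold beta
  gcongr

lemma exp_neg_beta {X : ℕ} (hX : 0 < X) {δ : ℝ} (hδ₀ : 0 < δ) {t : ℕ} (ht : 1 ≤ t) :
    X * Real.exp (-beta X δ t / 2) = 6 * δ / Real.pi ^ 2 * (1 / (t : ℝ) ^ 2) := by
  have h := beta_arg_pos hX hδ₀ ht
  have ht' : (0 : ℝ) < t := by exact_mod_cast ht
  have hX' : (0 : ℝ) < X := by exact_mod_cast hX
  rw [beta, show ∀ r : ℝ, -(2 * r) / 2 = -r from fun r => by ring, Real.exp_neg, Real.exp_log h]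
  field_simp

lemma sum_exp_neg_beta_le {X : ℕ} (hX : 0 < X) {δ : ℝ} (hδ₀ : 0 < δ) (T : ℕ) :
    ∑ t ∈ Finset.Icc 1 T, X * Real.exp (-beta X δ t / 2) ≤ δ := by
  rw [Finset.sum_congr rfl fun t ht => exp_neg_beta hX hδ₀ (Finset.mem_Icc.1 ht).1,
    ← Finset.mul_sum]
  -- The Basel series runs over all naturals; its term at `0` is `1 / 0 = 0`.
  have h : ∑ t ∈ Finset.Icc 1 T, 1 / (t : ℝ) ^ 2 ≤ Real.pi ^ 2 / 6 :=
    sum_le_hasSum _ (fun t _ => by positivity) hasSum_zeta_two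
  calc 6 * δ / Real.pi ^ 2 * ∑ t ∈ Finset.Icc 1 T, 1 / (t : ℝ) ^ 2
      ≤ 6 * δ / Real.pi ^ 2 * (Real.pi ^ 2 / 6) := by gcongr
    _ = δ := by field_simp

/-- The exploration parameter grows at most like the square root of the time. -/
lemma beta_le_mul_sqrt {X : ℕ} (hX : 0 < X) {δ : ℝ} (hδ₀ : 0 < δ) (hδ₁ : δ < 1) {T : ℕ}
    (hT : 1 ≤ T) : beta X δ T ≤ (beta X δ 1 + 8) * √T := by
  have hT' : (1 : ℝ) ≤ T := by exact_mod_cast hT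
  have hs : 1 ≤ √(T : ℝ) := Real.one_le_sqrt.2 hT'
  -- From `log T = 2 log √T` and `log s ≤ s - 1`. As `β_T = β_1 + 4 log T`, this gives the constant
  -- `8`.
  have hlog : Real.log T ≤ 2 * √T := by
    have h1 := Real.log_le_sub_one_of_pos (zero_lt_one.trans_le hs)
    rw [Real.log_sqrt (by positivity)] at h1
    linarith
  have h0 := beta_nonneg hX hδ₀ hδ₁ le_rfl
  have hsplit : beta X δ T = beta X δ 1 + 4 * Real.log T := by
    have h1 := beta_arg_pos hX hδ₀ (le_refl 1)
    unfold beta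
    rw [show X * (T : ℝ) ^ 2 * Real.pi ^ 2 / (6 * δ) =
      X * ((1 : ℕ) : ℝ) ^ 2 * Real.pi ^ 2 / (6 * δ) * (T : ℝ) ^ 2 by push_cast; ring,
      Real.log_mul h1.ne' (by positivity), Real.log_pow]
    push_cast
    ring
  rw [hsplit]
  nlinarith

end Beta

/-! ### Confidence intervals under adaptive sampling. -/

section Concentration

/-- Only subadditivity of the outer measure is used, so neither event has to be measurable. -/
lemma one_sub_le_measureReal {Ω : Type*} [MeasurableSpace Ω] {P : Measure Ω}
    [IsProbabilityMeasure P] {A S : Set Ω} {δ : ℝ} (hδ : 0 ≤ δ) (hA : P Aᶜ ≤ ENNReal.ofReal δ)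
    (hS : ∀ᵐ ω ∂P, ω ∈ A → ω ∈ S) : 1 - δ ≤ P.real S := by
  have h1 : (1 : ENNReal) ≤ P S + ENNReal.ofReal δ := by
    calc (1 : ENNReal) = P Set.univ := measure_univ.symm
      _ ≤ P (S ∪ Aᶜ ∪ {ω | ¬ (ω ∈ A → ω ∈ S)}) := by
        refine measure_mono fun ω _ => ?_
        by_cases h1 : ω ∈ A <;> by_cases h2 : ω ∈ S <;> simp [h1, h2]
      _ ≤ P S + P Aᶜ + 0 := by
        refine (measure_union_le _ _).trans (add_le_add (measure_union_le _ _) ?_)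
        exact (ae_iff.1 hS).le
      _ ≤ P S + ENNReal.ofReal δ := by rw [add_zero]; gcongr
  have h2 := ENNReal.toReal_mono (by finiteness) h1
  rw [ENNReal.toReal_one, ENNReal.toReal_add (by finiteness) (by finiteness),
    ENNReal.toReal_ofReal hδ] at h2
  rw [measureReal_def]
  linarith

variable {Ω : Type*} [MeasurableSpace Ω] {κ : 𝒳 → 𝒳 → ℝ} {σ : ℝ} {P : Measure Ω}
  {f : 𝒳 → Ω → ℝ} {noise : ℕ → Ω → ℝ} {argmax : ℕ → (𝒳 → ℝ) → 𝒳}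

lemma IsModel.aemeasurable_obsVec (h : IsModel κ σ P f noise) (p : List (𝒳 × ℕ)) :
    AEMeasurable (obsVec f noise p) P :=
  aemeasurable_pi_lambda _ fun _ =>
    (h.gaussian.aemeasurable _).add (h.noise_law _).aemeasurable

variable [Fintype 𝒳] [IsProbabilityMeasure P]

/-- Split according to the retained list: on each piece the design is fixed and independence of the
residual gives the factor `exp (-b / 2)`, so adaptivity costs nothing. -/
lemma IsModel.prob_deviation_le (h : IsModel κ σ P f noise) (hσ : 0 < σ)
    (hA : IsArgmaxRule argmax) (δ ε : ℝ) (t : ℕ) (x : 𝒳) {b : ℝ} (hb : 0 ≤ b) :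
    P {ω | √b * √(posteriorVar κ σ
          (dictionary κ σ δ ε argmax (fun x => f x ω) (fun s => noise s ω) t) x) <
        |f x ω - posteriorMean κ σ
          (dictionary κ σ δ ε argmax (fun x => f x ω) (fun s => noise s ω) t) x|} ≤
      ENNReal.ofReal (Real.exp (-b / 2)) := by
  set E := ENNReal.ofReal (Real.exp (-b / 2))
  set R : Ω → List (𝒳 × ℕ) := fun ω =>
    retained κ σ δ ε argmax (fun x => f x ω) (fun s => noise s ω) t with hR
  set dev : List (𝒳 × ℕ) → Set Ω := fun p => {ω | √b * √(posteriorVar κ σ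
          (observe (fun x => f x ω) (fun s => noise s ω) p) x) <
        |f x ω - posteriorMean κ σ
          (observe (fun x => f x ω) (fun s => noise s ω) p) x|} with hdev
  have hmeas : ∀ p, ∃ B, MeasurableSet B ∧ obsVec f noise p ⁻¹' B = {ω | R ω = p} := fun p =>
    measurableSet_retained_eq f noise δ ε h.posSemidef hσ hA t p
  -- The observations are only a.e. measurable; null measurability suffices to add up the masses of
  -- the disjoint pieces.
  have hnull : ∀ p, NullMeasurableSet {ω | R ω = p} P := by
    intro p
    obtain ⟨B, hB, hBp⟩ := hmeas p
    rw [← hBp]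
    exact (h.aemeasurable_obsVec p).nullMeasurableSet_preimage hB
  have hpath : ∀ p, P ({ω | R ω = p} ∩ dev p) ≤ P {ω | R ω = p} * E := by
    intro p
    by_cases hp : (p.map Prod.snd).Nodup
    · obtain ⟨B, hB, hBp⟩ := hmeas p
      obtain ⟨w, hm, hv, hw⟩ := exists_weights h.posSemidef hσ p x
      have hinj : Function.Injective fun i : Fin p.length => (p.get i).2 := by
        intro i j hij
        have := List.nodup_iff_injective_get.1 hp
          (a₁ := i.cast (List.length_map _).symm) (a₂ := j.cast (List.length_map _).symm)
          (by simpa using hij)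
        simpa [Fin.ext_iff] using this
      have := h.prob_residual_le (fun i => (p.get i).1) hinj x w hw hB hb
      rw [← hBp]
      simp only [hdev, hm, hv]
      exact this
    -- A list with a repeated time is never retained.
    · have : {ω | R ω = p} = ∅ := by
        ext ω
        simp only [Set.mem_ofPred_eq, Set.mem_empty_iff_false, iff_false]
        rintro rfl
        exact hp (retained_times κ σ δ ε argmax _ _ t).1
      simp [this]
  calc _ ≤ P (⋃ p, {ω | R ω = p} ∩ dev p) := by
        refine measure_mono fun ω hω => Set.mem_iUnion.2 ⟨R ω, rfl, ?_⟩
        simpa only [hdev, hR, observe_retained, Set.mem_ofPred_eq] using hω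
    _ ≤ ∑' p, P ({ω | R ω = p} ∩ dev p) := measure_iUnion_le _
    _ ≤ ∑' p, P {ω | R ω = p} * E := ENNReal.tsum_le_tsum hpath
    _ = (∑' p, P {ω | R ω = p}) * E := ENNReal.tsum_mul_right
    _ = P (⋃ p, {ω | R ω = p}) * E := by
        rw [measure_iUnion₀ _ hnull]
        intro p q hpq
        refine Disjoint.aedisjoint (Set.disjoint_left.2 fun ω (hp : R ω = p) (hq : R ω = q) => ?_)
        exact hpq (hp.symm.trans hq)
    _ ≤ 1 * E := by gcongr; exact prob_le_one
    _ = E := one_mul E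

/-- At all rounds up to `T`, the payoff of every action lies in its confidence interval. -/
def Concentrated (κ : 𝒳 → 𝒳 → ℝ) (σ δ ε : ℝ) (argmax : ℕ → (𝒳 → ℝ) → 𝒳) (f : 𝒳 → ℝ)
    (noise : ℕ → ℝ) (T : ℕ) : Prop :=
  ∀ t ∈ Finset.Icc 1 T, ∀ x,
    |f x - posteriorMean κ σ (dictionary κ σ δ ε argmax f noise (t - 1)) x| ≤
      √(beta (Fintype.card 𝒳) δ t) *
        √(posteriorVar κ σ (dictionary κ σ δ ε argmax f noise (t - 1)) x)

lemma IsModel.prob_not_concentrated_le [Nonempty 𝒳] (h : IsModel κ σ P f noise) (hσ : 0 < σ)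
    {δ : ℝ} (hδ₀ : 0 < δ) (hδ₁ : δ < 1) (hA : IsArgmaxRule argmax) (ε : ℝ) (T : ℕ) :
    P {ω | ¬ Concentrated κ σ δ ε argmax (fun x => f x ω) (fun s => noise s ω) T} ≤
      ENNReal.ofReal δ := by
  have hX : 0 < Fintype.card 𝒳 := Fintype.card_pos
  calc _ ≤ P (⋃ t ∈ Finset.Icc 1 T, ⋃ x ∈ (Finset.univ : Finset 𝒳),
        {ω | √(beta (Fintype.card 𝒳) δ t) * √(posteriorVar κ σ
          (dictionary κ σ δ ε argmax (fun x => f x ω) (fun s => noise s ω) (t - 1)) x) <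
        |f x ω - posteriorMean κ σ
          (dictionary κ σ δ ε argmax (fun x => f x ω) (fun s => noise s ω) (t - 1)) x|}) := by
        refine measure_mono fun ω hω => ?_
        simp only [Concentrated, Set.mem_ofPred_eq, not_forall, not_le] at hω
        obtain ⟨t, ht, x, hx⟩ := hω
        simp only [Set.mem_iUnion]
        exact ⟨t, ht, x, Finset.mem_univ x, hx⟩
    _ ≤ ∑ t ∈ Finset.Icc 1 T, ∑ x : 𝒳,
        ENNReal.ofReal (Real.exp (-beta (Fintype.card 𝒳) δ t / 2)) := by
        refine (measure_biUnion_finset_le _ _).trans (Finset.sum_le_sum fun t ht => ?_)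
        refine (measure_biUnion_finset_le _ _).trans (Finset.sum_le_sum fun x _ => ?_)
        -- Round `t` uses the dictionary of `t - 1` together with `β_t`.
        exact h.prob_deviation_le hσ hA δ ε (t - 1) x
          (beta_nonneg hX hδ₀ hδ₁ (Finset.mem_Icc.1 ht).1)
    _ = ENNReal.ofReal (∑ t ∈ Finset.Icc 1 T,
          (Fintype.card 𝒳 : ℝ) * Real.exp (-beta (Fintype.card 𝒳) δ t / 2)) := by
        rw [ENNReal.ofReal_sum_of_nonneg fun t _ => by positivity]
        refine Finset.sum_congr rfl fun t _ => ?_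
        rw [Finset.sum_const, nsmul_eq_mul, ENNReal.ofReal_mul (by positivity),
          ENNReal.ofReal_natCast, Finset.card_univ]
    _ ≤ ENNReal.ofReal δ := ENNReal.ofReal_le_ofReal (sum_exp_neg_beta_le hX hδ₀ T)

end Concentration

/-! ### Counting samples and bounding the regret along one sample path. -/

section Pathwise

variable [Fintype 𝒳] (κ : 𝒳 → 𝒳 → ℝ) (σ δ ε : ℝ) (argmax : ℕ → (𝒳 → ℝ) → 𝒳)
  (f : 𝒳 → ℝ) (noise : ℕ → ℝ)

lemma sum_updateTimes_succ (g : ℕ → ℝ) (T : ℕ) :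
    ∑ t ∈ updateTimes κ σ δ ε argmax f noise (T + 1), g t =
      ∑ t ∈ updateTimes κ σ δ ε argmax f noise T, g t +
        if ε < condEntropy κ σ (dictionary κ σ δ ε argmax f noise T)
          (action κ σ δ ε argmax f noise (T + 1)) then g (T + 1) else 0 := by
  unfold updateTimes
  rw [Finset.sum_filter, Finset.sum_filter, Finset.sum_Icc_succ_top (by omega)]
  rfl

lemma length_dictionary (T : ℕ) :
    ((dictionary κ σ δ ε argmax f noise T).length : ℝ) =
      (updateTimes κ σ δ ε argmax f noise T).card := by
  have h : ∀ T, ((updateTimes κ σ δ ε argmax f noise T).card : ℝ) =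
      ∑ t ∈ updateTimes κ σ δ ε argmax f noise T, (1 : ℝ) := fun T => by simp
  rw [h]
  induction T with
  | zero => simp [dictionary, updateTimes]
  | succ T ih =>
    rw [sum_updateTimes_succ, ← ih, dictionary_succ]
    split_ifs <;> simp

lemma card_updateTimes_le (T : ℕ) : (updateTimes κ σ δ ε argmax f noise T).card ≤ T :=
  (Finset.card_filter_le _ _).trans (by simp)

variable {κ σ}

lemma obsEntropy_dictionary_succ (hκ : (Matrix.of κ).PosSemidef) (hσ : 0 < σ) (T : ℕ) :
    obsEntropy κ σ (dictionary κ σ δ ε argmax f noise (T + 1)) =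
      obsEntropy κ σ (dictionary κ σ δ ε argmax f noise T) +
        if ε < condEntropy κ σ (dictionary κ σ δ ε argmax f noise T)
          (action κ σ δ ε argmax f noise (T + 1))
        then condEntropy κ σ (dictionary κ σ δ ε argmax f noise T)
          (action κ σ δ ε argmax f noise (T + 1)) else 0 := by
  rw [dictionary_succ]
  split_ifs
  · exact obsEntropy_append hκ hσ _ _ _
  · rw [add_zero]

lemma monotone_obsEntropy (hκ : (Matrix.of κ).PosSemidef) (hσ : 0 < σ) (hε : 0 < ε) :
    Monotone fun T => obsEntropy κ σ (dictionary κ σ δ ε argmax f noise T) := by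
  refine monotone_nat_of_le_succ fun T => ?_
  rw [obsEntropy_dictionary_succ δ ε argmax f noise hκ hσ]
  split_ifs with h
  · linarith
  · rw [add_zero]

/-- Every retained observation contributes more than the budget to the entropy. -/
lemma mul_card_updateTimes_le_obsEntropy (hκ : (Matrix.of κ).PosSemidef) (hσ : 0 < σ) (T : ℕ) :
    ε * (updateTimes κ σ δ ε argmax f noise T).card ≤
      obsEntropy κ σ (dictionary κ σ δ ε argmax f noise T) := by
  rw [← length_dictionary]
  induction T with
  | zero => simp [dictionary, obsEntropy_nil]
  | succ T ih =>
    rw [obsEntropy_dictionary_succ δ ε argmax f noise hκ hσ, dictionary_succ]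
    split_ifs with h
    · rw [List.length_append, List.length_singleton]
      push_cast
      linarith
    · simpa using ih

/-- As `ε > 0`, the entropy never decreases, so at every time it lies below its limit. -/
lemma card_updateTimes_le_div (hκ : (Matrix.of κ).PosSemidef) (hσ : 0 < σ) (hε : 0 < ε)
    {C h : ℝ} (hC : h ≤ C)
    (hlim : Tendsto (fun t => obsEntropy κ σ (dictionary κ σ δ ε argmax f noise t)) atTop (𝓝 h))
    (T : ℕ) : ((updateTimes κ σ δ ε argmax f noise T).card : ℝ) ≤ C / ε := by
  rw [le_div_iff₀ hε, mul_comm]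
  exact (mul_card_updateTimes_le_obsEntropy δ ε argmax f noise hκ hσ T).trans
    (((monotone_obsEntropy δ ε argmax f noise hκ hσ hε).ge_of_tendsto hlim T).trans hC)

lemma inv_sqrt_succ_le (n : ℕ) : 1 / √((n : ℝ) + 1) ≤ 2 * (√((n : ℝ) + 1) - √n) := by
  have h1 : 0 < √((n : ℝ) + 1) := Real.sqrt_pos.2 (by positivity)
  have h2 : √(n : ℝ) ≤ √((n : ℝ) + 1) := Real.sqrt_le_sqrt (by linarith)
  have h3 := Real.sq_sqrt (show (0 : ℝ) ≤ (n : ℝ) + 1 by positivity)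
  have h4 := Real.sq_sqrt (show (0 : ℝ) ≤ (n : ℝ) by positivity)
  rw [div_le_iff₀ h1]
  nlinarith [sq_nonneg (√((n : ℝ) + 1) - √n)]

/-- The widths of the confidence intervals at the sampled actions add up to the order of the
square root of the number of samples. -/
lemma sum_sqrt_posteriorVar_le [Nonempty 𝒳] (hκ : (Matrix.of κ).PosSemidef) (hσ : 0 < σ) {c : ℝ}
    (hc : ∀ x, κ x x + σ ^ 2 ≤ c) (T : ℕ) :
    ∑ t ∈ updateTimes κ σ δ ε argmax f noise T,
        √(posteriorVar κ σ (dictionary κ σ δ ε argmax f noise (t - 1))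
          (action κ σ δ ε argmax f noise t)) ≤
      2 * √c * Fintype.card 𝒳 * √((updateTimes κ σ δ ε argmax f noise T).card : ℝ) := by
  classical
  -- Potential argument: a sample at an action visited `n` times has width at most `√c / √(n + 1)`,
  -- which is at most the increase of `2√c √n` when `n` becomes `n + 1`.
  have hpot : ∑ t ∈ updateTimes κ σ δ ε argmax f noise T,
        √(posteriorVar κ σ (dictionary κ σ δ ε argmax f noise (t - 1))
          (action κ σ δ ε argmax f noise t)) ≤
      ∑ x, 2 * √c * √(visits (dictionary κ σ δ ε argmax f noise T) x : ℝ) := by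
    induction T with
    | zero => simp [updateTimes, dictionary, visits]
    | succ T ih =>
      rw [sum_updateTimes_succ, dictionary_succ]
      split_ifs with h
      · set D := dictionary κ σ δ ε argmax f noise T
        set a := action κ σ δ ε argmax f noise (T + 1)
        have hv : ∀ x y, visits (D ++ [(a, y)]) x = visits D x + if a = x then 1 else 0 := by
          intro x y
          simp [visits, List.countP_append, List.countP_cons]
        have hw : √(posteriorVar κ σ D a) ≤
            2 * √c * √((visits D a : ℝ) + 1) - 2 * √c * √(visits D a : ℝ) := by
          have h1 : posteriorVar κ σ D a ≤ c / ((visits D a : ℝ) + 1) :=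
            (posteriorVar_le_div hκ hσ D a).trans (by gcongr; exact hc a)
          calc √(posteriorVar κ σ D a) ≤ √(c / ((visits D a : ℝ) + 1)) := Real.sqrt_le_sqrt h1
            _ = √c * (1 / √((visits D a : ℝ) + 1)) := by
              rw [Real.sqrt_div' _ (by positivity)]; ring
            _ ≤ √c * (2 * (√((visits D a : ℝ) + 1) - √(visits D a : ℝ))) := by
              gcongr; exact inv_sqrt_succ_le _
            _ = _ := by ring
        have hsum : ∀ y, ∑ x, 2 * √c * √(visits (D ++ [(a, y)]) x : ℝ) =
            ∑ x, 2 * √c * √(visits D x : ℝ) +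
              (2 * √c * √((visits D a : ℝ) + 1) - 2 * √c * √(visits D a : ℝ)) := by
          intro y
          rw [← sub_eq_iff_eq_add', ← Finset.sum_sub_distrib, Finset.sum_eq_single a]
          · simp [hv]
          · intro x _ hx
            simp [hv, hx.symm]
          · simp
        rw [hsum]
        exact add_le_add ih hw
      · simpa using ih
  refine hpot.trans ?_
  -- Bounding each visit count by the total number of samples is crude and costs the factor `|𝒳|`,
  -- which the constant in (2) absorbs.
  have hle : ∀ x, 2 * √c * √(visits (dictionary κ σ δ ε argmax f noise T) x : ℝ) ≤
      2 * √c * √((updateTimes κ σ δ ε argmax f noise T).card : ℝ) := by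
    intro x
    rw [← length_dictionary]
    gcongr
    exact_mod_cast List.countP_le_length
  refine (Finset.sum_le_sum fun x _ => hle x).trans_eq ?_
  rw [Finset.sum_const, nsmul_eq_mul, Finset.card_univ]
  ring

variable {δ ε argmax f noise}

/-- Optimism: the payoff of any action is below its upper bound, hence below that of the selected
action, which exceeds the selected payoff by at most twice the width. -/
lemma regret_le_sum_sqrt_posteriorVar [Nonempty 𝒳] (hδ₀ : 0 < δ) (hA : IsArgmaxRule argmax)
    {T : ℕ} (hconc : Concentrated κ σ δ ε argmax f noise T) :
    regret κ σ δ ε argmax f noise T ≤ 2 * √(beta (Fintype.card 𝒳) δ T) *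
      ∑ t ∈ updateTimes κ σ δ ε argmax f noise T,
        √(posteriorVar κ σ (dictionary κ σ δ ε argmax f noise (t - 1))
          (action κ σ δ ε argmax f noise t)) := by
  rw [regret, Finset.mul_sum]
  refine Finset.sum_le_sum fun t ht => ?_
  have htI : t ∈ Finset.Icc 1 T := (Finset.mem_filter.1 ht).1
  obtain ⟨h1, hT⟩ := Finset.mem_Icc.1 htI
  have hβ : √(beta (Fintype.card 𝒳) δ t) ≤ √(beta (Fintype.card 𝒳) δ T) :=
    Real.sqrt_le_sqrt (beta_mono Fintype.card_pos hδ₀ h1 hT)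
  set D := dictionary κ σ δ ε argmax f noise (t - 1)
  set a := action κ σ δ ε argmax f noise t
  have hmax : ⨆ x, f x ≤ f a + 2 * √(beta (Fintype.card 𝒳) δ t) * √(posteriorVar κ σ D a) := by
    refine ciSup_le fun x => ?_
    have hx := (abs_le.1 (hconc t htI x)).2
    have hxa := (abs_le.1 (hconc t htI a)).1
    have hu : ucb κ σ (beta (Fintype.card 𝒳) δ t) D x ≤ ucb κ σ (beta (Fintype.card 𝒳) δ t) D a :=
      hA.le_argmax t _ x
    unfold ucb at hu
    linarith
  have := mul_le_mul_of_nonneg_right hβ (Real.sqrt_nonneg (posteriorVar κ σ D a))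
  linarith

/-- Since `log (1 + s) ≤ s` and `1 - e⁻¹ ≤ 1`, the product is at least `8` times the trace. It makes
`√(C₁ Z₁)` dominate twice the prior standard deviation. -/
lemma four_mul_le_C₁_mul_Z₁ (hκ : (Matrix.of κ).PosSemidef) (hσ : 0 < σ) (x : 𝒳) :
    4 * κ x x ≤ C₁ σ * Z₁ κ σ := by
  have hdiag : ∀ x, 0 ≤ κ x x := fun x => hκ.diag_nonneg (i := x)
  have htr : κ x x ≤ (Matrix.of κ).trace :=
    Finset.single_le_sum (f := fun x => κ x x) (fun y _ => hdiag y) (Finset.mem_univ x)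
  have htr0 : 0 ≤ (Matrix.of κ).trace := (hdiag x).trans htr
  have hs : 0 < σ ^ 2 := pow_pos hσ 2
  have hlog : 0 < Real.log (1 + (σ ^ 2)⁻¹) := Real.log_pos (by linarith [inv_pos.2 hs])
  have hlog' : Real.log (1 + (σ ^ 2)⁻¹) * σ ^ 2 ≤ 1 := by
    have h1 : Real.log (1 + (σ ^ 2)⁻¹) ≤ (σ ^ 2)⁻¹ := by
      linarith [Real.log_le_sub_one_of_pos (show 0 < 1 + (σ ^ 2)⁻¹ by positivity)]
    calc _ ≤ (σ ^ 2)⁻¹ * σ ^ 2 := by gcongr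
      _ = 1 := inv_mul_cancel₀ hs.ne'
  have he0 : Real.exp (-1) < 1 := by simp
  have he : 0 < 1 - Real.exp (-1) := by linarith
  have he1 : 1 - Real.exp (-1) ≤ 1 := by linarith [Real.exp_pos (-1)]
  unfold C₁ Z₁
  rw [div_mul_div_comm, le_div_iff₀ (by positivity)]
  have h2 : Real.log (1 + (σ ^ 2)⁻¹) * (σ ^ 2 * (1 - Real.exp (-1))) ≤ 1 := by
    rw [← mul_assoc]
    exact mul_le_one₀ hlog' he.le he1
  calc 4 * κ x x * (Real.log (1 + (σ ^ 2)⁻¹) * (σ ^ 2 * (1 - Real.exp (-1))))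
      ≤ 4 * κ x x * 1 := by
        refine mul_le_mul_of_nonneg_left h2 (mul_nonneg (by norm_num) (hdiag x))
    _ ≤ 8 * (Matrix.of κ).trace := by linarith

lemma regret_le_mul_card [Nonempty 𝒳] (hκ : (Matrix.of κ).PosSemidef) (hσ : 0 < σ) (hδ₀ : 0 < δ)
    (hδ₁ : δ < 1) (hA : IsArgmaxRule argmax) {T : ℕ} (hT : 1 ≤ T)
    (hconc : Concentrated κ σ δ ε argmax f noise T) :
    regret κ σ δ ε argmax f noise T ≤
      √(C₁ σ * Z₁ κ σ * beta (Fintype.card 𝒳) δ T) *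
        (updateTimes κ σ δ ε argmax f noise T).card := by
  have hβ : 0 ≤ beta (Fintype.card 𝒳) δ T := beta_nonneg Fintype.card_pos hδ₀ hδ₁ hT
  refine (regret_le_sum_sqrt_posteriorVar hδ₀ hA hconc).trans ?_
  have hw : ∀ t ∈ updateTimes κ σ δ ε argmax f noise T,
      √(posteriorVar κ σ (dictionary κ σ δ ε argmax f noise (t - 1))
          (action κ σ δ ε argmax f noise t)) ≤ √(C₁ σ * Z₁ κ σ) / 2 := by
    intro t _
    rw [le_div_iff₀ two_pos, show (2 : ℝ) = √4 by
      rw [show (4 : ℝ) = 2 ^ 2 by norm_num, Real.sqrt_sq two_pos.le],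
      ← Real.sqrt_mul' _ (by norm_num)]
    refine Real.sqrt_le_sqrt (le_trans ?_ (four_mul_le_C₁_mul_Z₁ hκ hσ
      (action κ σ δ ε argmax f noise t)))
    rw [mul_comm]
    gcongr
    exact posteriorVar_le_prior hκ hσ _ _
  calc _ ≤ 2 * √(beta (Fintype.card 𝒳) δ T) *
        ((updateTimes κ σ δ ε argmax f noise T).card • (√(C₁ σ * Z₁ κ σ) / 2)) := by
        gcongr
        exact Finset.sum_le_card_nsmul _ _ _ hw
    _ = _ := by
      rw [nsmul_eq_mul, Real.sqrt_mul' _ hβ]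
      ring

/-- At most `√T` samples give total width of order `T^(1/4)`, and `√β_T` is at most of order
`T^(1/4)`; the product is of order `√T`. -/
lemma regret_le_mul_sqrt [Nonempty 𝒳] (hκ : (Matrix.of κ).PosSemidef) (hσ : 0 < σ) (hδ₀ : 0 < δ)
    (hδ₁ : δ < 1) (hA : IsArgmaxRule argmax) {T : ℕ} (hT : 1 ≤ T)
    (hconc : Concentrated κ σ δ ε argmax f noise T)
    (hcard : ((updateTimes κ σ δ ε argmax f noise T).card : ℝ) ≤ √(T : ℝ)) :
    regret κ σ δ ε argmax f noise T ≤
      4 * Fintype.card 𝒳 * √(((Matrix.of κ).trace + σ ^ 2) *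
        (beta (Fintype.card 𝒳) δ 1 + 8)) * √(T : ℝ) := by
  set c := (Matrix.of κ).trace + σ ^ 2
  set B := beta (Fintype.card 𝒳) δ 1 + 8
  have hB : 0 ≤ B :=
    add_nonneg (beta_nonneg Fintype.card_pos hδ₀ hδ₁ le_rfl) (by norm_num)
  have hc : ∀ x, κ x x + σ ^ 2 ≤ c := fun x =>
    add_le_add (Finset.single_le_sum (f := fun x => κ x x)
      (fun y _ => hκ.diag_nonneg (i := y)) (Finset.mem_univ x)) le_rfl
  have hs : √(√(T : ℝ)) * √(√(T : ℝ)) = √(T : ℝ) := Real.mul_self_sqrt (Real.sqrt_nonneg _)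
  calc regret κ σ δ ε argmax f noise T
      ≤ 2 * √(beta (Fintype.card 𝒳) δ T) * _ := regret_le_sum_sqrt_posteriorVar hδ₀ hA hconc
    _ ≤ 2 * √(B * √(T : ℝ)) * (2 * √c * Fintype.card 𝒳 * √(√(T : ℝ))) := by
        gcongr
        · exact beta_le_mul_sqrt Fintype.card_pos hδ₀ hδ₁ hT
        · refine (sum_sqrt_posteriorVar_le δ ε argmax f noise hκ hσ hc T).trans ?_
          gcongr
    _ = 4 * Fintype.card 𝒳 * √(c * B) * (√(√(T : ℝ)) * √(√(T : ℝ))) := by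
        rw [Real.sqrt_mul hB, Real.sqrt_mul' _ hB]
        ring
    _ = _ := by rw [hs]

end Pathwise

end GPBandit

end

theorem corollary1 {𝒳 : Type*} [Fintype 𝒳] [Nonempty 𝒳] (κ : 𝒳 → 𝒳 → ℝ) (σ δ : ℝ)
    (hσ : 0 < σ) (hδ₀ : 0 < δ) (hδ₁ : δ < 1) :
    (∀ (C ε : ℝ) (T : ℕ), 0 < ε → 1 ≤ T →
      ∀ (Ω : Type*) [MeasurableSpace Ω] (P : Measure Ω) [IsProbabilityMeasure P]
        (f : 𝒳 → Ω → ℝ) (noise : ℕ → Ω → ℝ) (argmax : ℕ → (𝒳 → ℝ) → 𝒳),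
        GPBandit.IsModel κ σ P f noise → GPBandit.IsArgmaxRule argmax →
        GPBandit.FiniteEntropy κ σ δ ε argmax P f noise C →
        1 - δ ≤ P.real {ω |
          GPBandit.regret κ σ δ ε argmax (fun x => f x ω) (fun t => noise t ω) T
            ≤ √(GPBandit.C₁ σ * GPBandit.Z₁ κ σ * GPBandit.beta (Fintype.card 𝒳) δ T)
              * min (C / ε) (T : ℝ)}) ∧
    (∃ K : ℝ, ∀ (C : ℝ) (T : ℕ), 0 < C → 1 ≤ T →
      ∀ (Ω : Type*) [MeasurableSpace Ω] (P : Measure Ω) [IsProbabilityMeasure P]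
        (f : 𝒳 → Ω → ℝ) (noise : ℕ → Ω → ℝ) (argmax : ℕ → (𝒳 → ℝ) → 𝒳),
        GPBandit.IsModel κ σ P f noise → GPBandit.IsArgmaxRule argmax →
        GPBandit.FiniteEntropy κ σ δ (C / √(T : ℝ)) argmax P f noise C →
        1 - δ ≤ P.real {ω |
          GPBandit.regret κ σ δ (C / √(T : ℝ)) argmax (fun x => f x ω) (fun t => noise t ω) T
            ≤ K * √(T : ℝ)} ∧
        ∀ᵐ ω ∂P,
          ((GPBandit.dictionary κ σ δ (C / √(T : ℝ)) argmax (fun x => f x ω)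
            (fun t => noise t ω) T).length : ℝ) ≤ √(T : ℝ)) := by
  refine ⟨fun C ε T hε hT Ω _ P _ f noise argmax h hA hfin => ?_,
    4 * Fintype.card 𝒳 * √(((Matrix.of κ).trace + σ ^ 2) *
      (GPBandit.beta (Fintype.card 𝒳) δ 1 + 8)),
    fun C T hC hT Ω _ P _ f noise argmax h hA hfin => ?_⟩
  · refine GPBandit.one_sub_le_measureReal (A := {ω | GPBandit.Concentrated κ σ δ ε argmax
      (fun x => f x ω) (fun s => noise s ω) T}) hδ₀.le
      (h.prob_not_concentrated_le hσ hδ₀ hδ₁ hA ε T) ?_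
    filter_upwards [hfin] with ω ⟨l, hl, hlim⟩ hconc
    have hcard := GPBandit.card_updateTimes_le_div δ ε argmax _ _ h.posSemidef hσ hε hl hlim T
    refine (GPBandit.regret_le_mul_card h.posSemidef hσ hδ₀ hδ₁ hA hT hconc).trans ?_
    gcongr
    exact le_min hcard (by exact_mod_cast GPBandit.card_updateTimes_le κ σ δ ε argmax _ _ T)
  · have hT' : 0 < √(T : ℝ) := Real.sqrt_pos.2 (by exact_mod_cast hT)
    have hcard : ∀ᵐ ω ∂P, ((GPBandit.updateTimes κ σ δ (C / √(T : ℝ)) argmax (fun x => f x ω)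
        (fun s => noise s ω) T).card : ℝ) ≤ √(T : ℝ) := by
      filter_upwards [hfin] with ω ⟨l, hl, hlim⟩
      refine (GPBandit.card_updateTimes_le_div δ _ argmax _ _ h.posSemidef hσ
        (div_pos hC hT') hl hlim T).trans_eq ?_
      -- With `ε = C / √T` the bound `C / ε` is `√T`, so `C` cancels and the constant in (2) does
      -- not depend on it.
      field_simp
    refine ⟨GPBandit.one_sub_le_measureReal (A := {ω | GPBandit.Concentrated κ σ δ
      (C / √(T : ℝ)) argmax (fun x => f x ω) (fun s => noise s ω) T}) hδ₀.le
      (h.prob_not_concentrated_le hσ hδ₀ hδ₁ hA _ T) ?_, ?_⟩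
    · filter_upwards [hcard] with ω hω hconc
      exact GPBandit.regret_le_mul_sqrt h.posSemidef hσ hδ₀ hδ₁ hA hT hconc hω
    · filter_upwards [hcard] with ω hω
      rwa [GPBandit.length_dictionary]
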